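/- Let $\tau=\{\tau_0,\tau_1,\tau_2,\dots\}$ be a renewal process: $\tau_0=0$ and the inter-arrival times $\tau_k-\tau_{k-1}$ are i.i.d. with values in $\{1,2,3,\dots\}\cup\{\infty\}$; once a renewal time is infinite all later ones are, and for an integer $n\ge 0$ we write $n\in\tau$ if $\tau_k=n$ for some $k\ge 0$. Let $U_n=\sum_{k=0}^n \mathbf P(k\in\tau)$. A function $L:\mathbb R\to\mathbb R$ is called slowly varying if it is measurable, positive on some half-line $[x_0,\infty)$, and $L(tx)/L(x)\to 1$ as $x\to\infty$ for every $t>0$. A real sequence $(a_n)$ is called slowly varying if $a_n=L(n)$ for all large $n$, with $L$ slowly varying, and regularly varying if $a_n=n^{\rho}L(n)$ for all large $n$, with some $\rho\in\mathbb R$ and $L$ slowly varying. Theorem. Assume that $\mathbf P(n\in\tau)$ is regularly varying and that $U_n$ is slowly varying (no assumption is made on the regularity of $\mathbf P(\tau_1=n)$). Then there exist $\varepsilon_n\in(0,1)$ with $\varepsilon_n\to 0$ and $\varepsilon_n n\to\infty$ such that $$\frac{1}{\varepsilon_n n}\sum_{(1-\varepsilon_n)n<k\le n}\mathbf P(\tau_1=k)\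 \sim\ \mathbf P(\tau_1>n)^2\,\mathbf P(n\in\tau)\qquad\text{as } n\to\infty .$$ If, moreover, $\mathbf P(\tau_1=n)$ is regularly varying, then $$\mathbf P(\tau_1=n)\ \sim\ \mathbf P(\tau_1>n)^2\,\mathbf P(n\in\tau)\qquad\text{as } n\to\infty .$$ -/

import Mathlib

open MeasureTheory ProbabilityTheory Filter Asymptotics
open scoped Topology

namespace Renewal

/-- A slowly varying function (at infinity): measurable, eventually positive, and
`L (t x) / L x → 1` as `x → ∞` for every `t > 0`. -/
def SlowlyVarying (L : ℝ → ℝ) : Prop :=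
  Measurable L ∧ (∀ᶠ x in atTop, 0 < L x) ∧
    ∀ t : ℝ, 0 < t → Tendsto (fun x => L (t * x) / L x) atTop (𝓝 1)

/-- A slowly varying sequence: it coincides, for large `n`, with the restriction to the integers
of a slowly varying function. -/
def SlowlyVaryingSeq (a : ℕ → ℝ) : Prop :=
  ∃ L : ℝ → ℝ, SlowlyVarying L ∧ ∀ᶠ n : ℕ in atTop, a n = L n

/-- A regularly varying sequence: `a n = n ^ ρ * L n` for large `n`, for some real index `ρ` and
some slowly varying function `L`. -/
def RegularlyVaryingSeq (a : ℕ → ℝ) : Prop :=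
  ∃ (ρ : ℝ) (L : ℝ → ℝ), SlowlyVarying L ∧ ∀ᶠ n : ℕ in atTop, a n = (n : ℝ) ^ ρ * L n

variable {Ω : Type*} [MeasurableSpace Ω]

/-- The variables `ξ 0, ξ 1, …` are the inter-arrival times of a (possibly transient) renewal
process: i.i.d. with values in `{1, 2, …} ∪ {∞}`. -/
structure IsInterarrival (ξ : ℕ → Ω → ℕ∞) (P : Measure Ω) : Prop where
  measurable : ∀ i, Measurable (ξ i)
  indep : iIndepFun ξ P
  identDistrib : ∀ i, IdentDistrib (ξ i) (ξ 0) P P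
  pos : ∀ᵐ ω ∂P, 1 ≤ ξ 0 ω

/-- The `k`-th renewal time `τ_k`, with `τ_0 = 0`. -/
def renewalTime (ξ : ℕ → Ω → ℕ∞) (k : ℕ) (ω : Ω) : ℕ∞ := ∑ i ∈ Finset.range k, ξ i ω

/-- The set `τ = {τ_0, τ_1, …}` of finite renewal times. -/
def renewalSet (ξ : ℕ → Ω → ℕ∞) (ω : Ω) : Set ℕ := {n | ∃ k, renewalTime ξ k ω = (n : ℕ∞)}

/-- The renewal mass function `n ↦ P(n ∈ τ)`. -/
noncomputable def renewalMass (ξ : ℕ → Ω → ℕ∞) (P : Measure Ω) (n : ℕ) : ℝ :=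
  P.real {ω | n ∈ renewalSet ξ ω}

/-- `U_n = ∑_{k ≤ n} P(k ∈ τ)`. -/
noncomputable def renewalSum (ξ : ℕ → Ω → ℕ∞) (P : Measure Ω) (n : ℕ) : ℝ :=
  ∑ k ∈ Finset.range (n + 1), renewalMass ξ P k

/-- The inter-arrival distribution `n ↦ P(τ_1 = n)`. -/
noncomputable def interarrivalMass (ξ : ℕ → Ω → ℕ∞) (P : Measure Ω) (n : ℕ) : ℝ :=
  P.real {ω | renewalTime ξ 1 ω = (n : ℕ∞)}

/-- The tail `n ↦ P(τ_1 > n)`, the event `τ_1 = ∞` included. -/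
noncomputable def interarrivalTail (ξ : ℕ → Ω → ℕ∞) (P : Measure Ω) (n : ℕ) : ℝ :=
  P.real {ω | (n : ℕ∞) < renewalTime ξ 1 ω}

end Renewal

/-! Write `u n = P(n ∈ τ)`, `U n = ∑_{k ≤ n} u k`, `T n = P(τ_1 > n)`. Everything is drawn from the
last-renewal decomposition `∑_{k ≤ n} u k * T (n - k) = 1` (`IsInterarrival.last_renewal`); the
recurrent and the transient case need no separate treatment.

Summing the decomposition over `n < N` gives `∑_{j < N} T j * U (N - 1 - j) = N`. As `U` is slowly
varying, `∑_{j < n} T j ∼ n / U n`, and since `T` is monotone, `T n ∼ 1 / U n`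
(`IsRenewalPair.tendsto_sum_tail`, `IsRenewalPair.tendsto_tail_mul_cumul`).

For the increments of `T`, subtract the decompositions at times `m = n - w` and `n`:
`∑_{k ≤ m} u k * (T (m - k) - T (n - k)) = ∑_{j < w} u (n - j) * T j`. With `w ≈ ε n` and `ε` small
the right side is about `ε n * u n / U n`. On the left, the terms with `k ≤ p`, where `p ≈ η n` and
`η` is small compared to `ε`, give about `U p * (T (n - w) - T n)`, with `U p ∼ U n`. The other terms
are negligible: those with `p < k ≤ n / 4` because `U (n / 4) - U p = o(U n)` while each increment
obeys the upper bound just found; those with `k > n / 4` because there `u k` is comparable to `u n`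
and the increments telescope to a difference of two quantities equivalent to `w / U n`. Hence
`T ((1 - ε) n) - T n` is `ε n * u n / U n ^ 2`, up to a factor which is close to `1` when `ε` is
small and `n` large (`IsRenewalPair.increment_asymptotic`). The first claim follows by letting
`ε` tend to `0` slowly along `n` (`exists_shrinking_windows`), the second because a regularly varying
sequence is almost constant on a short window (`RegularlyVaryingSeq.window_average`).

The comparisons of `u`, `U` and `P(τ_1 = ·)` at nearby indices rest on the uniform convergence
theorem for measurable slowly varying functions (`SlowlyVarying.uniform`). -/

namespace Renewal

/-! ### Uniform convergence for slowly varying functions -/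

/-- The uniform convergence theorem in additive form. If it failed along `x n → ∞`, `v n ∈ [0, R]`,
then convergence in measure of the increments of `h` based at `x n` and at `x n + v n` would yield
a common point `z ∈ [R, 2R]` whose increments from both bases are small, a contradiction. -/
lemma uniform_increment_of_tendsto {h : ℝ → ℝ} (hm : Measurable h)
    (hh : ∀ v, Tendsto (fun x => h (x + v) - h x) atTop (𝓝 0)) {R δ : ℝ} (hR : 0 < R)
    (hδ : 0 < δ) : ∃ X, ∀ x ≥ X, ∀ v ∈ Set.Icc 0 R, |h (x + v) - h x| ≤ δ := by
  by_contra! hcon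
  choose x hx v hv hbad using fun n : ℕ => hcon (n : ℝ)
  have hx_top : Tendsto x atTop atTop := tendsto_atTop_mono hx tendsto_natCast_atTop_atTop
  have hxv_top : Tendsto (fun n => x n + v n) atTop atTop :=
    tendsto_atTop_mono (fun n => le_add_of_nonneg_right (hv n).1) hx_top
  set μ : Measure ℝ := volume.restrict (Set.Icc 0 (2 * R)) with hμ
  have : IsFiniteMeasure μ :=
    ⟨by rw [hμ, Measure.restrict_apply_univ]; exact measure_Icc_lt_top⟩
  have key : ∀ y : ℕ → ℝ, Tendsto y atTop atTop →
      ∀ᶠ n in atTop, μ {z | δ / 2 ≤ ‖(h (y n + z) - h (y n)) - 0‖} < ENNReal.ofReal (R / 2) := by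
    intro y hy
    have hc : TendstoInMeasure μ (fun n z => h (y n + z) - h (y n)) atTop (fun _ => 0) :=
      tendstoInMeasure_of_tendsto_ae
        (fun n => ((hm.comp (measurable_const_add _)).sub_const _).aestronglyMeasurable)
        (Eventually.of_forall fun z => (hh z).comp hy)
    exact (tendstoInMeasure_iff_norm.1 hc (δ / 2) (by positivity)).eventually_lt_const
      (by simpa using hR)
  obtain ⟨n, hA, hB⟩ := ((key x hx_top).and (key _ hxv_top)).exists
  set A := {z | δ / 2 ≤ ‖(h (x n + z) - h (x n)) - 0‖} with hAdef
  set B := {z | δ / 2 ≤ ‖(h (x n + v n + z) - h (x n + v n)) - 0‖} with hBdef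
  have hA' : volume (A ∩ Set.Icc 0 (2 * R)) < ENNReal.ofReal (R / 2) :=
    (Measure.le_restrict_apply _ _).trans_lt hA
  have hB' : volume (B ∩ Set.Icc 0 (2 * R)) < ENNReal.ofReal (R / 2) :=
    (Measure.le_restrict_apply _ _).trans_lt hB
  have hsub : ¬ Set.Icc R (2 * R) ⊆ (A ∩ Set.Icc 0 (2 * R)) ∪
      (fun z => z + (-v n)) ⁻¹' (B ∩ Set.Icc 0 (2 * R)) := by
    intro hs
    have h1 := (measure_mono hs).trans (measure_union_le (μ := volume) _ _)
    rw [measure_preimage_add_right, Real.volume_Icc] at h1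
    have h2 := h1.trans_lt (ENNReal.add_lt_add hA' hB')
    rw [← ENNReal.ofReal_add (by positivity) (by positivity)] at h2
    rw [ENNReal.ofReal_lt_ofReal_iff (by positivity)] at h2
    linarith
  obtain ⟨z, hz, hzn⟩ := Set.not_subset.1 hsub
  have hv0 := (hv n).1
  have hvR := (hv n).2
  have hzA : z ∉ A := fun h' => hzn (Or.inl ⟨h', by linarith [hz.1], hz.2⟩)
  have hzB : z + (-v n) ∉ B := fun h' =>
    hzn (Or.inr ⟨h', by linarith [hz.1], by linarith [hz.2]⟩)
  simp only [hAdef, hBdef, Set.mem_ofPred_eq, not_le, sub_zero, Real.norm_eq_abs] at hzA hzB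
  have e : x n + v n + (z + -v n) = x n + z := by ring
  rw [e] at hzB
  have := hbad n
  have h3 : h (x n + v n) - h (x n) =
      (h (x n + z) - h (x n)) - (h (x n + z) - h (x n + v n)) := by ring
  rw [h3] at this
  have := abs_sub (h (x n + z) - h (x n)) (h (x n + z) - h (x n + v n))
  linarith

/-- The uniform convergence theorem, on the compact sets `[c, 1 / c]` of dilation factors. -/
lemma SlowlyVarying.uniform {L : ℝ → ℝ} (hL : SlowlyVarying L) {c θ : ℝ} (hc : 0 < c) (hc1 : c < 1)
    (hθ : 0 < θ) : ∀ᶠ x in atTop, ∀ y, c * x ≤ y → y ≤ x / c → |L y - L x| ≤ θ * L x := by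
  obtain ⟨hm, hpos, hlim⟩ := hL
  set h : ℝ → ℝ := fun s => Real.log (L (Real.exp s)) with hh
  have hmeas : Measurable h := Real.measurable_log.comp (hm.comp Real.measurable_exp)
  have hinc : ∀ v, Tendsto (fun x => h (x + v) - h x) atTop (𝓝 0) := by
    intro v
    have h1 := (hlim (Real.exp v) (Real.exp_pos v)).comp Real.tendsto_exp_atTop
    have h2 := (Real.continuousAt_log one_ne_zero).tendsto.comp h1
    rw [Real.log_one] at h2
    refine h2.congr' ?_
    have hp1 := Real.tendsto_exp_atTop.eventually hpos
    have hp2 := (Real.tendsto_exp_atTop.comp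
      (tendsto_atTop_add_const_right atTop v tendsto_id)).eventually hpos
    filter_upwards [hp1, hp2] with x h1 h2
    simp only [Function.comp, id, hh] at h1 h2 ⊢
    rw [← Real.exp_add, add_comm v x, Real.log_div h2.ne' h1.ne']
  -- `|exp s - 1| ≤ θ` for `|s| ≤ δ`
  obtain ⟨δ, hδ, hδθ⟩ : ∃ δ > 0, ∀ s, |s| ≤ δ → |Real.exp s - 1| ≤ θ := by
    have := Metric.continuousAt_iff.1 (Real.continuous_exp.continuousAt (x := 0)) θ hθ
    obtain ⟨δ, hδ, H⟩ := this
    refine ⟨δ / 2, by positivity, fun s hs => ?_⟩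
    have := H (x := s) (by rw [Real.dist_eq, sub_zero]; linarith)
    rw [Real.dist_eq, Real.exp_zero] at this
    exact this.le
  have hlogc : Real.log c < 0 := Real.log_neg hc hc1
  obtain ⟨X, hX⟩ := uniform_increment_of_tendsto hmeas hinc (neg_pos.2 hlogc) hδ
  obtain ⟨Y, hY⟩ := eventually_atTop.1 hpos
  filter_upwards [eventually_ge_atTop (Real.exp X), eventually_ge_atTop (Real.exp X / c),
    eventually_ge_atTop Y, eventually_ge_atTop (Y / c)] with x hx1 hx2 hx3 hx4 y hy1 hy2
  rw [div_le_iff₀' hc] at hx2 hx4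
  have hx0 : 0 < x := (Real.exp_pos X).trans_le hx1
  have hy0 : 0 < y := (mul_pos hc hx0).trans_le hy1
  have hLx := hY x hx3
  have hLy := hY y (hx4.trans hy1)
  have e1 : h (Real.log x) = Real.log (L x) := by simp [hh, Real.exp_log hx0]
  have e2 : h (Real.log y) = Real.log (L y) := by simp [hh, Real.exp_log hy0]
  have hXx : X ≤ Real.log x := (Real.le_log_iff_exp_le hx0).2 hx1
  have hXy : X ≤ Real.log y := (Real.le_log_iff_exp_le hy0).2 (hx2.trans hy1)
  have l1 : Real.log c + Real.log x ≤ Real.log y := by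
    rw [← Real.log_mul hc.ne' hx0.ne']
    exact Real.log_le_log (by positivity) hy1
  have l2 : Real.log y ≤ Real.log x - Real.log c := by
    rw [← Real.log_div hx0.ne' hc.ne']
    exact Real.log_le_log hy0 hy2
  have hlog : |Real.log (L y) - Real.log (L x)| ≤ δ := by
    rcases le_total (Real.log x) (Real.log y) with hle | hle
    · have := hX _ hXx (Real.log y - Real.log x) ⟨by linarith, by linarith⟩
      rwa [add_sub_cancel, e1, e2] at this
    · have := hX _ hXy (Real.log x - Real.log y) ⟨by linarith, by linarith⟩
      rwa [add_sub_cancel, e1, e2, abs_sub_comm] at this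
  have h3 := hδθ _ hlog
  rw [Real.exp_sub, Real.exp_log hLx, Real.exp_log hLy] at h3
  have h4 : L y - L x = (L y / L x - 1) * L x := by field_simp
  rw [h4, abs_mul, abs_of_pos hLx]
  exact mul_le_mul_of_nonneg_right h3 hLx.le

lemma SlowlyVaryingSeq.eventually_pos {a : ℕ → ℝ} (ha : SlowlyVaryingSeq a) :
    ∀ᶠ n in atTop, 0 < a n := by
  obtain ⟨L, hL, ha⟩ := ha
  filter_upwards [ha, tendsto_natCast_atTop_atTop.eventually hL.2.1] with n h1 h2
  rwa [h1]

lemma eventually_forall_ge_mul {p : ℕ → Prop} (hp : ∀ᶠ n in atTop, p n) {c : ℝ} (hc : 0 < c) :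
    ∀ᶠ n : ℕ in atTop, ∀ k : ℕ, c * n ≤ k → p k := by
  obtain ⟨N, hN⟩ := eventually_atTop.1 hp
  have := (tendsto_natCast_atTop_atTop (R := ℝ)).eventually_ge_atTop (N / c)
  filter_upwards [this] with n hn k hk
  rw [div_le_iff₀' hc] at hn
  exact hN k (by exact_mod_cast hn.trans hk)

lemma SlowlyVaryingSeq.uniform {a : ℕ → ℝ} (ha : SlowlyVaryingSeq a) {c θ : ℝ} (hc : 0 < c)
    (hc1 : c < 1) (hθ : 0 < θ) :
    ∀ᶠ n : ℕ in atTop, ∀ k : ℕ, c * n ≤ k → (k : ℝ) ≤ n / c → |a k - a n| ≤ θ * a n := by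
  obtain ⟨L, hL, ha⟩ := ha
  filter_upwards [eventually_forall_ge_mul ha hc, ha,
    tendsto_natCast_atTop_atTop.eventually (hL.uniform hc hc1 hθ)] with n h1 h2 h3 k hk1 hk2
  rw [h1 k hk1, h2]
  exact h3 k hk1 hk2

lemma RegularlyVaryingSeq.eventually_pos {a : ℕ → ℝ} (ha : RegularlyVaryingSeq a) :
    ∀ᶠ n in atTop, 0 < a n := by
  obtain ⟨ρ, L, hL, ha⟩ := ha
  filter_upwards [ha, tendsto_natCast_atTop_atTop.eventually hL.2.1, eventually_gt_atTop 0]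
    with n h1 h2 h3
  rw [h1]
  positivity

/-- For a regularly varying sequence the ratio `a k / a n` is uniformly close to `(k / n) ^ ρ`. -/
lemma RegularlyVaryingSeq.uniform {a : ℕ → ℝ} (ha : RegularlyVaryingSeq a) :
    ∃ ρ : ℝ, ∀ c θ : ℝ, 0 < c → c < 1 → 0 < θ → ∀ᶠ n : ℕ in atTop, ∀ k : ℕ, c * n ≤ k →
      (k : ℝ) ≤ n / c → |a k - ((k : ℝ) / n) ^ ρ * a n| ≤ θ * (((k : ℝ) / n) ^ ρ * a n) := by
  obtain ⟨ρ, L, hL, ha⟩ := ha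
  refine ⟨ρ, fun c θ hc hc1 hθ => ?_⟩
  filter_upwards [eventually_forall_ge_mul ha hc, ha, eventually_gt_atTop 0,
    tendsto_natCast_atTop_atTop.eventually (hL.uniform hc hc1 hθ)] with n h1 h2 hn h3 k hk1 hk2
  have hn' : (0 : ℝ) < n := by exact_mod_cast hn
  have e : ((k : ℝ) / n) ^ ρ * ((n : ℝ) ^ ρ * L n) = (k : ℝ) ^ ρ * L n := by
    rw [← mul_assoc, ← Real.mul_rpow (by positivity) hn'.le, div_mul_cancel₀ _ hn'.ne']
  rw [h1 k hk1, h2, e, ← mul_sub, abs_mul, abs_of_nonneg (by positivity : (0:ℝ) ≤ (k:ℝ) ^ ρ),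
    mul_left_comm]
  exact mul_le_mul_of_nonneg_left (h3 k hk1 hk2) (by positivity)

/-- A regularly varying sequence is comparable to a constant on `[c n, n / c]`. -/
lemma RegularlyVaryingSeq.bounded {a : ℕ → ℝ} (ha : RegularlyVaryingSeq a) {c : ℝ} (hc : 0 < c)
    (hc1 : c < 1) : ∃ C : ℝ, 0 < C ∧ ∀ᶠ n : ℕ in atTop, ∀ k : ℕ, c * n ≤ k → (k : ℝ) ≤ n / c →
      a k ≤ C * a n := by
  obtain ⟨ρ, H⟩ := ha.uniform
  -- `t ^ ρ` is bounded on the compact interval `[c, 1 / c]`, away from `0`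
  have hcont : ContinuousOn (fun t : ℝ => t ^ ρ) (Set.Icc c (1 / c)) := fun t ht =>
    (Real.continuousAt_rpow_const t ρ (Or.inl (hc.trans_le ht.1).ne')).continuousWithinAt
  obtain ⟨M, hM⟩ := (isCompact_Icc.image_of_continuousOn hcont).bddAbove
  refine ⟨2 * max M 1, by positivity, ?_⟩
  filter_upwards [H c 1 hc hc1 one_pos, ha.eventually_pos, eventually_gt_atTop 0]
    with n h1 h2 hn k hk1 hk2
  have hn' : (0 : ℝ) < n := by exact_mod_cast hn
  have h3 : ((k : ℝ) / n) ^ ρ ≤ M := hM ⟨(k : ℝ) / n, ⟨(le_div_iff₀ hn').2 hk1, by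
    rw [div_le_div_iff₀ hn' hc]; rw [le_div_iff₀ hc] at hk2; linarith⟩, rfl⟩
  have h4 := (abs_le.1 (h1 k hk1 hk2)).2
  have h5 : ((k : ℝ) / n) ^ ρ * a n ≤ max M 1 * a n :=
    mul_le_mul_of_nonneg_right (h3.trans (le_max_left _ _)) h2.le
  linarith

/-- A regularly varying sequence is almost constant on short windows around `n`. -/
lemma RegularlyVaryingSeq.locally_flat {a : ℕ → ℝ} (ha : RegularlyVaryingSeq a) {θ : ℝ}
    (hθ : 0 < θ) : ∃ δ : ℝ, 0 < δ ∧ ∀ᶠ n : ℕ in atTop, ∀ k : ℕ, |(k : ℝ) - n| ≤ δ * n →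
      |a k - a n| ≤ θ * a n := by
  obtain ⟨ρ, H⟩ := ha.uniform
  have hcont : ContinuousAt (fun t : ℝ => t ^ ρ) 1 :=
    Real.continuousAt_rpow_const 1 ρ (Or.inl one_ne_zero)
  obtain ⟨θ', hθ', hθ1, hθ2⟩ : ∃ θ' : ℝ, 0 < θ' ∧ θ' ≤ 1 ∧ 3 * θ' ≤ θ :=
    ⟨min 1 (θ / 3), by positivity, min_le_left _ _, by linarith [min_le_right 1 (θ / 3)]⟩
  obtain ⟨δ, hδ, hδθ⟩ := Metric.continuousAt_iff.1 hcont θ' hθ'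
  refine ⟨min (δ / 2) (1 / 2), by positivity, ?_⟩
  filter_upwards [H (1 / 2) θ' (by norm_num) (by norm_num) hθ', ha.eventually_pos,
    eventually_gt_atTop 0] with n h1 h2 hn k hk
  have hn' : (0 : ℝ) < n := by exact_mod_cast hn
  have hk1 : |(k : ℝ) - n| ≤ 1 / 2 * n :=
    hk.trans (mul_le_mul_of_nonneg_right (min_le_right _ _) hn'.le)
  have hk2 : |(k : ℝ) - n| ≤ δ / 2 * n :=
    hk.trans (mul_le_mul_of_nonneg_right (min_le_left _ _) hn'.le)
  have h3 := h1 k (by linarith [(abs_le.1 hk1).1]) (by linarith [(abs_le.1 hk1).2])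
  have h4 : |((k : ℝ) / n) ^ ρ - 1| < θ' := by
    have := hδθ (x := (k : ℝ) / n) (by
      rw [Real.dist_eq]
      have : (k : ℝ) / n - 1 = (k - n) / n := by field_simp
      rw [this, abs_div, abs_of_pos hn', div_lt_iff₀ hn']
      nlinarith)
    rwa [Real.dist_eq, Real.one_rpow] at this
  set t := ((k : ℝ) / n) ^ ρ
  have h5 : a k - a n = (a k - t * a n) + (t - 1) * a n := by ring
  rw [h5]
  refine (abs_add_le _ _).trans ?_
  rw [abs_mul, abs_of_pos h2]
  have h6 : t ≤ 2 := by linarith [(abs_lt.1 h4).2]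
  have h7 : θ' * (t * a n) ≤ θ' * (2 * a n) := by gcongr
  have h8 : |t - 1| * a n ≤ θ' * a n := by gcongr
  nlinarith

/-! ### Finite identities and inequalities from the last-renewal decomposition -/

/-- The sum of the terms of index at most `n`. -/
noncomputable def cumul (a : ℕ → ℝ) (n : ℕ) : ℝ := ∑ k ∈ Finset.range (n + 1), a k

/-- A renewal mass function `u` and the tail `T` of the inter-arrival law, reduced to the
deterministic facts which tie them: the last renewal up to time `n` occurs at exactly one
`k ≤ n`. -/
structure IsRenewalPair (u T : ℕ → ℝ) : Prop where
  mass_nonneg : ∀ n, 0 ≤ u n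
  tail_nonneg : ∀ n, 0 ≤ T n
  tail_antitone : Antitone T
  last_renewal : ∀ n, ∑ k ∈ Finset.range (n + 1), u k * T (n - k) = 1

namespace IsRenewalPair

variable {u T : ℕ → ℝ}

lemma cumul_mono (h : IsRenewalPair u T) : Monotone (cumul u) := fun _ _ hmn =>
  Finset.sum_le_sum_of_subset_of_nonneg (Finset.range_subset_range.2 (by lia))
    fun k _ _ => h.mass_nonneg k

lemma cumul_pos (h : IsRenewalPair u T) (n : ℕ) : 0 < cumul u n := by
  have h0 : u 0 * T 0 = 1 := by simpa using h.last_renewal 0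
  have h1 : 0 < u 0 := lt_of_le_of_ne (h.mass_nonneg 0) fun e => by simp [← e] at h0
  have h2 : cumul u 0 = u 0 := by simp [cumul]
  exact (h2 ▸ h1).trans_le (h.cumul_mono (Nat.zero_le n))

/-- The last-renewal decompositions at the times `0, …, N - 1`, added up. -/
lemma sum_tail_mul_cumul (h : IsRenewalPair u T) (N : ℕ) :
    ∑ j ∈ Finset.range N, T j * cumul u (N - 1 - j) = N := by
  induction N with
  | zero => simp
  | succ N ih =>
    have h1 : ∑ j ∈ Finset.range (N + 1), T j * cumul u (N + 1 - 1 - j) =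
        ∑ j ∈ Finset.range N, T j * cumul u (N - 1 - j) +
          ∑ j ∈ Finset.range (N + 1), T j * u (N - j) := by
      rw [Finset.sum_range_succ, Finset.sum_range_succ _ N, ← add_assoc, ← Finset.sum_add_distrib]
      congr 1
      · refine Finset.sum_congr rfl fun j hj => ?_
        have hj := Finset.mem_range.1 hj
        obtain ⟨d, rfl⟩ : ∃ d, N = j + d + 1 := ⟨N - j - 1, by lia⟩
        have e1 : j + d + 1 + 1 - 1 - j = d + 1 := by lia
        have e2 : j + d + 1 - 1 - j = d := by lia
        have e3 : j + d + 1 - j = d + 1 := by lia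
        rw [e1, e2, e3, cumul, Finset.sum_range_succ, ← cumul]
        ring
      · simp [cumul]
    rw [h1, ih]
    have h2 := h.last_renewal N
    rw [← Finset.sum_flip] at h2
    push_cast
    rw [add_right_inj, ← h2]
    refine Finset.sum_congr rfl fun j hj => ?_
    rw [mul_comm, Nat.sub_sub_self (Nat.lt_succ_iff.1 (Finset.mem_range.1 hj))]

lemma le_sum_tail_mul_cumul (h : IsRenewalPair u T) (N : ℕ) :
    (N : ℝ) ≤ (∑ j ∈ Finset.range N, T j) * cumul u N := by
  rw [← h.sum_tail_mul_cumul N, Finset.sum_mul]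
  exact Finset.sum_le_sum fun j _ =>
    mul_le_mul_of_nonneg_left (h.cumul_mono (by lia)) (h.tail_nonneg j)

lemma sum_tail_mul_cumul_le (h : IsRenewalPair u T) (M d : ℕ) :
    (∑ j ∈ Finset.range M, T j) * cumul u d ≤ ((M + d : ℕ) : ℝ) := by
  rw [← h.sum_tail_mul_cumul (M + d), Finset.sum_range_add, Finset.sum_mul]
  refine le_add_of_le_of_nonneg (Finset.sum_le_sum fun j hj => ?_) (Finset.sum_nonneg fun j _ =>
    mul_nonneg (h.tail_nonneg _) (h.cumul_pos _).le)
  have := Finset.mem_range.1 hj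
  exact mul_le_mul_of_nonneg_left (h.cumul_mono (by lia)) (h.tail_nonneg j)

lemma cumul_mul_tail_le (h : IsRenewalPair u T) (n : ℕ) : cumul u n * T n ≤ 1 := by
  rw [← h.last_renewal n, cumul, Finset.sum_mul]
  exact Finset.sum_le_sum fun k _ =>
    mul_le_mul_of_nonneg_left (h.tail_antitone (by lia)) (h.mass_nonneg k)

/-- The difference of the last-renewal decompositions at times `m` and `m + w`. -/
lemma sum_mass_mul_increment (h : IsRenewalPair u T) (m w : ℕ) :
    ∑ k ∈ Finset.range (m + 1), u k * (T (m - k) - T (m + w - k)) =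
      ∑ j ∈ Finset.range w, u (m + w - j) * T j := by
  have h1 := h.last_renewal m
  have h2 := h.last_renewal (m + w)
  rw [show m + w + 1 = (m + 1) + w by ring, Finset.sum_range_add] at h2
  have h3 : ∑ j ∈ Finset.range w, u (m + 1 + j) * T (m + w - (m + 1 + j)) =
      ∑ j ∈ Finset.range w, u (m + w - j) * T j := by
    rw [← Finset.sum_range_reflect]
    refine Finset.sum_congr rfl fun j hj => ?_
    have := Finset.mem_range.1 hj
    congr 2 <;> lia
  simp only [mul_sub, Finset.sum_sub_distrib]
  linarith

/-- Upper bound for an increment of the tail: all windows `(a - k, a + w + p - k]` with `k ≤ p`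
contain `(a, a + w]`. -/
lemma cumul_mul_increment_le (h : IsRenewalPair u T) {p a : ℕ} (hpa : p ≤ a) (w : ℕ) :
    cumul u p * (T a - T (a + w)) ≤
      ∑ j ∈ Finset.range (w + p), u (a + (w + p) - j) * T j := by
  rw [← h.sum_mass_mul_increment, cumul, Finset.sum_mul]
  refine (Finset.sum_le_sum fun k hk => ?_).trans
    (Finset.sum_le_sum_of_subset_of_nonneg (Finset.range_subset_range.2 (by lia : p + 1 ≤ a + 1))
      fun k _ _ => mul_nonneg (h.mass_nonneg k) (sub_nonneg.2 (h.tail_antitone (by lia))))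
  have := Finset.mem_range.1 hk
  exact mul_le_mul_of_nonneg_left (sub_le_sub (h.tail_antitone (by lia))
    (h.tail_antitone (by lia))) (h.mass_nonneg k)

lemma cumul_mul_increment_le_of_bound (h : IsRenewalPair u T) {p a w : ℕ} {D : ℝ} (hpa : p ≤ a)
    (hD : ∀ k, a < k → k ≤ a + (w + p) → u k ≤ D) :
    cumul u p * (T a - T (a + w)) ≤ D * ∑ j ∈ Finset.range (w + p), T j := by
  refine (h.cumul_mul_increment_le hpa w).trans ?_
  rw [Finset.mul_sum]
  refine Finset.sum_le_sum fun j hj => mul_le_mul_of_nonneg_right ?_ (h.tail_nonneg j)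
  have := Finset.mem_range.1 hj
  exact hD _ (by lia) (by lia)

/-- The total increment over shifts telescopes. -/
lemma sum_increment_le (h : IsRenewalPair u T) {r w b : ℕ} (hb : r + w ≤ b) :
    ∑ j ∈ Finset.range r, (T j - T (j + w)) ≤ ∑ j ∈ Finset.range w, T j - w * T b := by
  have e1 := Finset.sum_range_add T r w
  have e2 := Finset.sum_range_add T w r
  rw [add_comm w r, e1] at e2
  have e3 : ∑ j ∈ Finset.range w, T b ≤ ∑ j ∈ Finset.range w, T (r + j) :=
    Finset.sum_le_sum fun j hj => h.tail_antitone (by have := Finset.mem_range.1 hj; lia)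
  rw [Finset.sum_const, Finset.card_range, nsmul_eq_mul] at e3
  simp only [Finset.sum_sub_distrib, add_comm _ w]
  linarith

/-- Lower bound for an increment of the tail: all windows `(a + p - k, a + p + w - k]` with `k ≤ p`
are contained in `(a, a + p + w]`. The shifts `p < k ≤ q` and `q < k ≤ a + p` contribute the two
error terms. -/
lemma le_cumul_mul_increment (h : IsRenewalPair u T) {a p q w : ℕ} {D M : ℝ} (hpq : p ≤ q)
    (hqa : q ≤ a + p) (hD0 : 0 ≤ D) (hD : ∀ k, q < k → k ≤ a + p → u k ≤ D)
    (hM : ∀ k, p < k → k ≤ q → T (a + p - k) - T (a + p + w - k) ≤ M) :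
    ∑ j ∈ Finset.range w, u (a + p + w - j) * T j ≤
      cumul u p * (T a - T (a + p + w)) + (cumul u q - cumul u p) * M +
        D * (∑ j ∈ Finset.range w, T j - w * T (a + p + w)) := by
  rw [← h.sum_mass_mul_increment]
  obtain ⟨s, rfl⟩ := Nat.exists_eq_add_of_le hpq
  obtain ⟨r, hr⟩ := Nat.exists_eq_add_of_le hqa
  set F : ℕ → ℝ := fun k => u k * (T (a + p - k) - T (a + p + w - k)) with hF
  have e1 : ∑ k ∈ Finset.range (a + p + 1), F k = ∑ k ∈ Finset.range (p + 1), F k +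
      ∑ i ∈ Finset.range s, F (p + 1 + i) + ∑ i ∈ Finset.range r, F (p + 1 + s + i) := by
    rw [hr, show p + s + r + 1 = p + 1 + s + r by ring, Finset.sum_range_add,
      Finset.sum_range_add]
  have e2 : cumul u (p + s) - cumul u p = ∑ i ∈ Finset.range s, u (p + 1 + i) := by
    rw [cumul, cumul, show p + s + 1 = p + 1 + s by ring, Finset.sum_range_add]
    ring
  rw [e1]
  refine add_le_add (add_le_add ?_ ?_) ?_
  · rw [cumul, Finset.sum_mul]
    refine Finset.sum_le_sum fun k hk => ?_
    have := Finset.mem_range.1 hk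
    exact mul_le_mul_of_nonneg_left (sub_le_sub (h.tail_antitone (by lia))
      (h.tail_antitone (by lia))) (h.mass_nonneg k)
  · rw [e2, Finset.sum_mul]
    refine Finset.sum_le_sum fun i hi => ?_
    have := Finset.mem_range.1 hi
    exact mul_le_mul_of_nonneg_left (hM _ (by lia) (by lia)) (h.mass_nonneg _)
  · refine le_trans ?_ (mul_le_mul_of_nonneg_left
      (h.sum_increment_le (r := r) (w := w) (b := a + p + w) (by lia)) hD0)
    rw [Finset.mul_sum, ← Finset.sum_range_reflect]
    refine Finset.sum_le_sum fun i hi => ?_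
    have hi := Finset.mem_range.1 hi
    have e3 : a + p - (p + 1 + s + (r - 1 - i)) = i := by lia
    have e4 : a + p + w - (p + 1 + s + (r - 1 - i)) = i + w := by lia
    simp only [hF, e3, e4]
    exact mul_le_mul_of_nonneg_right (hD _ (by lia) (by lia))
      (sub_nonneg.2 (h.tail_antitone (by lia)))

end IsRenewalPair

/-! ### Asymptotics of the tail and of its sums -/

lemma tendsto_floor_mul_div {c : ℝ} (hc : 0 ≤ c) :
    Tendsto (fun n : ℕ => (⌊c * (n : ℝ)⌋₊ : ℝ) / n) atTop (𝓝 c) :=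
  (tendsto_nat_floor_mul_div_atTop hc).comp tendsto_natCast_atTop_atTop

/-- If `k n / n → c > 0`, then `k n ∈ [c' n, n / c']` eventually, for some `c'`. -/
lemma exists_eventually_bounds {k : ℕ → ℕ} {c : ℝ} (hc : 0 < c)
    (hk : Tendsto (fun n => (k n : ℝ) / n) atTop (𝓝 c)) :
    ∃ c' : ℝ, 0 < c' ∧ c' < 1 ∧
      ∀ᶠ n : ℕ in atTop, c' * n ≤ k n ∧ (k n : ℝ) ≤ n / c' := by
  refine ⟨min (c / 2) (1 / (2 * c + 1)), by positivity, ?_, ?_⟩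
  · refine (min_le_right _ _).trans_lt ?_
    rw [div_lt_one (by positivity)]
    linarith
  · have h1 : 1 / (2 * c + 1) ≤ 1 / (2 * c) := by gcongr; linarith
    filter_upwards [hk.eventually_lt_const (by linarith : c < 2 * c),
      hk.eventually_const_lt (by linarith : c / 2 < c), eventually_gt_atTop 0] with n h2 h3 hn
    have hn' : (0 : ℝ) < n := by exact_mod_cast hn
    rw [div_lt_iff₀ hn'] at h2
    rw [lt_div_iff₀ hn'] at h3
    constructor
    · exact (mul_le_mul_of_nonneg_right (min_le_left _ _) hn'.le).trans h3.le
    · rw [le_div_iff₀ (by positivity)]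
      calc (k n : ℝ) * min (c / 2) (1 / (2 * c + 1)) ≤ (2 * c * n) * (1 / (2 * c)) := by
            gcongr
            exact (min_le_right _ _).trans h1
        _ = n := by field_simp

lemma SlowlyVaryingSeq.tendsto_div {a : ℕ → ℝ} (ha : SlowlyVaryingSeq a) {k : ℕ → ℕ} {c : ℝ}
    (hc : 0 < c) (hk : Tendsto (fun n => (k n : ℝ) / n) atTop (𝓝 c)) :
    Tendsto (fun n => a (k n) / a n) atTop (𝓝 1) := by
  obtain ⟨c', h0, h1, hev⟩ := exists_eventually_bounds hc hk
  rw [Metric.tendsto_nhds]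
  intro θ hθ
  filter_upwards [hev, ha.uniform h0 h1 (half_pos hθ), ha.eventually_pos] with n h2 h3 h4
  rw [Real.dist_eq, div_sub_one h4.ne', abs_div, abs_of_pos h4, div_lt_iff₀ h4]
  have := h3 _ h2.1 h2.2
  nlinarith

namespace IsRenewalPair

variable {u T : ℕ → ℝ}

/-- The partial sums of the tail: `∑_{j < k} T j ∼ c * n / U n` when `k ∼ c * n`. The upper bound
compares with the summed decomposition up to time `k + η n`, for an arbitrarily small `η`. -/
lemma tendsto_sum_tail (h : IsRenewalPair u T) (hU : SlowlyVaryingSeq (cumul u)) {k : ℕ → ℕ}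
    {c : ℝ} (hc : 0 < c) (hk : Tendsto (fun n => (k n : ℝ) / n) atTop (𝓝 c)) :
    Tendsto (fun n => (∑ j ∈ Finset.range (k n), T j) * cumul u n / n) atTop (𝓝 c) := by
  rw [tendsto_order]
  constructor
  · intro b hb
    have h1 : Tendsto (fun n => (k n : ℝ) / n * (cumul u (k n) / cumul u n)⁻¹) atTop (𝓝 c) := by
      simpa using hk.mul ((hU.tendsto_div hc hk).inv₀ one_ne_zero)
    filter_upwards [h1.eventually_const_lt hb, eventually_gt_atTop 0] with n h2 hn
    refine h2.trans_le ?_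
    have hn' : (0 : ℝ) < n := by exact_mod_cast hn
    have p1 := h.cumul_pos n
    have p2 := h.cumul_pos (k n)
    have h3 := h.le_sum_tail_mul_cumul (k n)
    rw [inv_div, div_mul_div_comm, div_le_div_iff₀ (by positivity) hn']
    have h4 := mul_le_mul_of_nonneg_right h3 (mul_nonneg p1.le hn'.le)
    nlinarith
  · intro b hb
    have hη : 0 < (b - c) / 2 := by linarith
    have hfl := tendsto_floor_mul_div hη.le
    have h1 : Tendsto (fun n : ℕ => ((k n : ℝ) / n + (⌊(b - c) / 2 * (n : ℝ)⌋₊ : ℝ) / n) *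
        (cumul u ⌊(b - c) / 2 * (n : ℝ)⌋₊ / cumul u n)⁻¹) atTop (𝓝 (c + (b - c) / 2)) := by
      simpa using (hk.add hfl).mul ((hU.tendsto_div hη hfl).inv₀ one_ne_zero)
    filter_upwards [h1.eventually_lt_const (by linarith : c + (b - c) / 2 < b),
      eventually_gt_atTop 0] with n h2 hn
    refine lt_of_le_of_lt ?_ h2
    have hn' : (0 : ℝ) < n := by exact_mod_cast hn
    set d := ⌊(b - c) / 2 * (n : ℝ)⌋₊
    have p1 := h.cumul_pos n
    have p2 := h.cumul_pos d
    have h3 := h.sum_tail_mul_cumul_le (k n) d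
    push_cast at h3
    rw [inv_div, ← add_div, div_mul_div_comm, div_le_div_iff₀ hn' (by positivity)]
    have h4 := mul_le_mul_of_nonneg_right h3 (mul_nonneg p1.le hn'.le)
    nlinarith

lemma tendsto_tail_mul_cumul (h : IsRenewalPair u T) (hU : SlowlyVaryingSeq (cumul u)) :
    Tendsto (fun n => T n * cumul u n) atTop (𝓝 1) := by
  have hid : Tendsto (fun n : ℕ => ((id n : ℕ) : ℝ) / n) atTop (𝓝 1) :=
    tendsto_const_nhds.congr' (by
      filter_upwards [eventually_gt_atTop 0] with n hn
      have hn' : (0 : ℝ) < n := by exact_mod_cast hn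
      simp [hn'.ne'])
  have h2 : Tendsto (fun n : ℕ => ((2 * n : ℕ) : ℝ) / n) atTop (𝓝 2) :=
    tendsto_const_nhds.congr' (by
      filter_upwards [eventually_gt_atTop 0] with n hn
      have hn' : (0 : ℝ) < n := by exact_mod_cast hn
      push_cast
      field_simp)
  -- `n * T n` dominates the sum of `T` over `[n, 2 n)`, which is asymptotic to `n / U n`
  have hlow := (h.tendsto_sum_tail hU two_pos h2).sub (h.tendsto_sum_tail hU one_pos hid)
  norm_num at hlow
  refine tendsto_of_tendsto_of_tendsto_of_le_of_le' hlow tendsto_const_nhds ?_ ?_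
  · filter_upwards [eventually_gt_atTop 0] with n hn
    have hn' : (0 : ℝ) < n := by exact_mod_cast hn
    rw [div_sub_div_same, div_le_iff₀ hn', ← sub_mul, mul_right_comm]
    refine mul_le_mul_of_nonneg_right ?_ (h.cumul_pos n).le
    rw [two_mul, Finset.sum_range_add, add_sub_cancel_left]
    refine (Finset.sum_le_sum fun j _ => h.tail_antitone (Nat.le_add_right n j)).trans_eq ?_
    simp [mul_comm]
  · exact Eventually.of_forall fun n => by rw [mul_comm]; exact h.cumul_mul_tail_le n

/-- Upper bound for the mass of a window of length about `ε n` ending at `n`, when `u ≤ K * u n`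
on the slightly larger window. -/
lemma increment_eventually_le (h : IsRenewalPair u T) (hU : SlowlyVaryingSeq (cumul u))
    (hpos : ∀ᶠ n in atTop, 0 < u n) {a p : ℕ → ℕ} {ε η K x : ℝ} (hε : 0 < ε)
    (hη : 0 < η) (hη1 : η + ε < 1) (ha : Tendsto (fun n => (a n : ℝ) / n) atTop (𝓝 (1 - ε)))
    (hp : Tendsto (fun n => (p n : ℝ) / n) atTop (𝓝 η)) (han : ∀ n, a n ≤ n)
    (hK : ∀ᶠ n in atTop, ∀ k, a n < k → k ≤ n + p n → u k ≤ K * u n)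
    (hx : K * (ε + η) < x) :
    ∀ᶠ n : ℕ in atTop, (T (a n) - T n) * cumul u n ^ 2 ≤ x * (n * u n) := by
  have hwp : Tendsto (fun n => ((n - a n + p n : ℕ) : ℝ) / n) atTop (𝓝 (ε + η)) := by
    have : Tendsto (fun n => 1 - (a n : ℝ) / n + (p n : ℝ) / n) atTop (𝓝 (1 - (1 - ε) + η)) :=
      (tendsto_const_nhds.sub ha).add hp
    rw [sub_sub_cancel] at this
    refine this.congr' ?_
    filter_upwards [eventually_gt_atTop 0] with n hn
    have hn' : (0 : ℝ) < n := by exact_mod_cast hn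
    push_cast [Nat.cast_sub (han n)]
    field_simp
  have hS := h.tendsto_sum_tail hU (by positivity) hwp
  have hlim := (hS.const_mul K).mul ((hU.tendsto_div hη hp).inv₀ one_ne_zero)
  rw [inv_one, mul_one] at hlim
  have hpa : ∀ᶠ n : ℕ in atTop, (p n : ℝ) / n < (a n : ℝ) / n :=
    hp.eventually_lt ha (by linarith)
  filter_upwards [hlim.eventually_lt_const hx, hpa, hK, hpos, eventually_gt_atTop 0]
    with n h1 h2 h3 h4 hn
  have hn' : (0 : ℝ) < n := by exact_mod_cast hn
  rw [div_lt_div_iff_of_pos_right hn'] at h2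
  have hpa' : p n ≤ a n := by exact_mod_cast h2.le
  have e : a n + (n - a n) = n := by have := han n; lia
  have hb := h.cumul_mul_increment_le_of_bound (w := n - a n) (D := K * u n) hpa'
    (fun k hk1 hk2 => h3 k hk1 (by lia))
  rw [e] at hb
  set S := ∑ j ∈ Finset.range (n - a n + p n), T j
  have q1 := h.cumul_pos n
  have q2 := h.cumul_pos (p n)
  have e1 : K * (S * cumul u n / n) * (cumul u (p n) / cumul u n)⁻¹ =
      K * S * cumul u n ^ 2 / (n * cumul u (p n)) := by
    field_simp
  rw [e1, div_lt_iff₀ (by positivity)] at h1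
  -- clear the factor `U p`
  refine le_of_mul_le_mul_left ?_ q2
  calc cumul u (p n) * ((T (a n) - T n) * cumul u n ^ 2)
      = (cumul u (p n) * (T (a n) - T n)) * cumul u n ^ 2 := by ring
    _ ≤ (K * u n * S) * cumul u n ^ 2 := by gcongr
    _ = (K * S * cumul u n ^ 2) * u n := by ring
    _ ≤ (x * (n * cumul u (p n))) * u n := by gcongr
    _ = _ := by ring

/-- Lower bound for the mass of a window of length about `ε n` ending at `n`, when `u ≥ K * u n`
on this window and `u` is comparable to `u n` on `[n / 4, n]`. -/
lemma eventually_le_increment (h : IsRenewalPair u T) (hU : SlowlyVaryingSeq (cumul u))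
    (hpos : ∀ᶠ n in atTop, 0 < u n) {a p : ℕ → ℕ} {ε η K C x : ℝ} (hε1 : ε < 1 / 4)
    (hη : 0 < η) (hηε : η < ε) (ha : Tendsto (fun n => (a n : ℝ) / n) atTop (𝓝 (1 - ε)))
    (hp : Tendsto (fun n => (p n : ℝ) / n) atTop (𝓝 η)) (hC0 : 0 < C)
    (hC : ∀ᶠ n : ℕ in atTop, ∀ k : ℕ, 1 / 4 * (n : ℝ) ≤ k → k ≤ n → u k ≤ C * u n)
    (hK : ∀ᶠ n in atTop, ∀ k, a n < k → k ≤ n → K * u n ≤ u k)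
    (hx : x < K * (ε - η)) :
    ∀ᶠ n : ℕ in atTop, x * (n * u n) ≤ (T (a n) - T n) * cumul u n ^ 2 := by
  set q : ℕ → ℕ := fun n => ⌊(1 / 4 : ℝ) * (n : ℝ)⌋₊ with hq
  have hqlim : Tendsto (fun n => (q n : ℝ) / n) atTop (𝓝 (1 / 4)) :=
    tendsto_floor_mul_div (by norm_num)
  have hapn : ∀ᶠ n in atTop, a n + p n ≤ n := by
    filter_upwards [(ha.add hp).eventually_lt_const (by linarith : 1 - ε + η < 1),
      eventually_gt_atTop 0] with n h1 hn
    have hn' : (0 : ℝ) < n := by exact_mod_cast hn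
    rw [← add_div, div_lt_one hn'] at h1
    exact_mod_cast h1.le
  have hw : Tendsto (fun n => ((n - (a n + p n) : ℕ) : ℝ) / n) atTop (𝓝 (ε - η)) := by
    have : Tendsto (fun n => 1 - ((a n : ℝ) / n + (p n : ℝ) / n)) atTop (𝓝 (1 - (1 - ε + η))) :=
      tendsto_const_nhds.sub (ha.add hp)
    rw [show 1 - (1 - ε + η) = ε - η by ring] at this
    refine this.congr' ?_
    filter_upwards [eventually_gt_atTop 0, hapn] with n hn h1
    have hn' : (0 : ℝ) < n := by exact_mod_cast hn
    rw [Nat.cast_sub h1]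
    push_cast
    field_simp
  have hwp : Tendsto (fun n => ((n - (a n + p n) + p n : ℕ) : ℝ) / n) atTop (𝓝 ε) := by
    have := hw.add hp
    rw [sub_add_cancel] at this
    refine this.congr fun n => ?_
    push_cast
    ring
  have hUp := hU.tendsto_div hη hp
  have hUq := hU.tendsto_div (by norm_num) hqlim
  have hSw := h.tendsto_sum_tail hU (by linarith) hw
  have hSwp := h.tendsto_sum_tail hU (by linarith) hwp
  have hT := h.tendsto_tail_mul_cumul hU
  -- the two error terms tend to `0`
  have hlim := ((((hw.mul hT).const_mul K).sub
    (((hUq.sub hUp).mul (hUp.inv₀ one_ne_zero)).mul (hSwp.const_mul C))).sub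
    ((hSw.sub (hw.mul hT)).const_mul C)).mul (hUp.inv₀ one_ne_zero)
  simp only [mul_one, sub_self, mul_zero, zero_mul, sub_zero, inv_one] at hlim
  have hpq : ∀ᶠ n : ℕ in atTop, (p n : ℝ) / n < (q n : ℝ) / n :=
    hp.eventually_lt hqlim (by linarith)
  have hqa : ∀ᶠ n : ℕ in atTop, (q n : ℝ) / n + 1 / 4 < (a n : ℝ) / n :=
    (hqlim.add_const _).eventually_lt ha (by linarith)
  filter_upwards [hlim.eventually_const_lt hx, hpq, hqa, hC, hK, hpos, hapn,
    eventually_gt_atTop 0] with n h1 h2 h3 h4 h5 h6 h7 hn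
  have hn' : (0 : ℝ) < n := by exact_mod_cast hn
  rw [div_lt_div_iff_of_pos_right hn'] at h2
  have hpq' : p n ≤ q n := by exact_mod_cast h2.le
  rw [lt_div_iff₀ hn', add_mul, div_mul_cancel₀ _ hn'.ne'] at h3
  have hqa' : q n ≤ a n := by
    have : (q n : ℝ) ≤ a n := by linarith
    exact_mod_cast this
  obtain ⟨w, hwdef⟩ := Nat.exists_eq_add_of_le h7
  have hw' : n - (a n + p n) = w := by lia
  rw [hw'] at h1
  set S := ∑ j ∈ Finset.range w, T j
  set S' := ∑ j ∈ Finset.range (w + p n), T j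
  have q1 := h.cumul_pos n
  have q2 := h.cumul_pos (p n)
  have hD : ∀ k, q n < k → k ≤ a n + p n → u k ≤ C * u n := fun k hk1 hk2 => by
    refine h4 k ?_ (by lia)
    have := Nat.lt_floor_add_one ((1 / 4 : ℝ) * (n : ℝ))
    have h8 : ((q n : ℝ) + 1) ≤ k := by exact_mod_cast hk1
    exact this.le.trans h8
  have hM : ∀ k, p n < k → k ≤ q n → T (a n + p n - k) - T (a n + p n + w - k) ≤
      C * u n * S' / cumul u (p n) := fun k hk1 hk2 => by
    rw [le_div_iff₀ q2, mul_comm]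
    have := h.cumul_mul_increment_le_of_bound (p := p n) (a := a n + p n - k) (w := w)
      (D := C * u n) (by lia) (fun i hi1 hi2 => by
        refine h4 i ?_ (by lia)
        have h8 : a n ≤ i + q n := by lia
        have h9 : (a n : ℝ) ≤ i + q n := by exact_mod_cast h8
        linarith)
    rwa [show a n + p n - k + w = a n + p n + w - k by lia] at this
  have hb := h.le_cumul_mul_increment (w := w) hpq' (by lia) (by positivity) hD hM
  have hleft : K * u n * (w * T n) ≤ ∑ j ∈ Finset.range w, u (a n + p n + w - j) * T j := by
    calc K * u n * (w * T n) = ∑ j ∈ Finset.range w, K * u n * T n := by simp; ring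
      _ ≤ _ := Finset.sum_le_sum fun j hj => by
        have := Finset.mem_range.1 hj
        by_cases hK0 : 0 ≤ K * u n
        · exact mul_le_mul (h5 _ (by lia) (by lia)) (h.tail_antitone (by lia))
            (h.tail_nonneg _) (h.mass_nonneg _)
        · exact (mul_nonpos_of_nonpos_of_nonneg (not_le.1 hK0).le (h.tail_nonneg _)).trans
            (mul_nonneg (h.mass_nonneg _) (h.tail_nonneg _))
  have hb' := hleft.trans hb
  rw [← hwdef] at hb'
  set G := T (a n) - T n
  set Un := cumul u n
  set Up := cumul u (p n)
  set Uq := cumul u (q n)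
  have h8 : (K * (w / n * (T n * Un)) - (Uq / Un - Up / Un) * (Up / Un)⁻¹ * (C * (S' * Un / n)) -
      C * (S * Un / n - w / n * (T n * Un))) * (Up / Un)⁻¹ * (Up * n * u n) =
      (K * u n * (w * T n) - (Uq - Up) * (C * u n * S' / Up) - C * u n * (S - w * T n)) *
        Un ^ 2 := by
    field_simp
  refine le_of_mul_le_mul_left ?_ q2
  calc Up * (x * (n * u n)) = x * (Up * n * u n) := by ring
    _ ≤ _ := mul_le_mul_of_nonneg_right h1.le (by positivity)
    _ = _ := h8
    _ ≤ (Up * G) * Un ^ 2 := by gcongr; linarith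
    _ = _ := by ring

/-- The increments of the tail over short windows, with their first-order constant. -/
lemma increment_asymptotic (h : IsRenewalPair u T) (hU : SlowlyVaryingSeq (cumul u))
    (hu : RegularlyVaryingSeq u) {θ : ℝ} (hθ : 0 < θ) :
    ∃ ε₀ : ℝ, 0 < ε₀ ∧ ε₀ < 1 ∧ ∀ ε, 0 < ε → ε ≤ ε₀ → ∀ᶠ n : ℕ in atTop,
      |(T ⌊(1 - ε) * (n : ℝ)⌋₊ - T n) - ε * n * (T n ^ 2 * u n)| ≤
        θ * (ε * n * (T n ^ 2 * u n)) := by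
  obtain ⟨s, hs, hs1, hsθ⟩ : ∃ s : ℝ, 0 < s ∧ s ≤ 1 / 20 ∧ 20 * s ≤ θ :=
    ⟨min (1 / 20) (θ / 20), by positivity, min_le_left _ _, by
      linarith [min_le_right (1 / 20) (θ / 20)]⟩
  obtain ⟨δ, hδ, hflat⟩ := hu.locally_flat hs
  obtain ⟨C, hC, hcomp⟩ := hu.bounded (c := 1 / 4) (by norm_num) (by norm_num)
  refine ⟨min (δ / 2) (1 / 5), by positivity, (min_le_right _ _).trans_lt (by norm_num),
    fun ε hε hεle => ?_⟩
  have hε1 : ε ≤ 1 / 5 := hεle.trans (min_le_right _ _)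
  have hεδ : ε ≤ δ / 2 := hεle.trans (min_le_left _ _)
  have ha := tendsto_floor_mul_div (c := 1 - ε) (by linarith)
  have hη : 0 < s * ε := by positivity
  have hp := tendsto_floor_mul_div hη.le
  have hpos := hu.eventually_pos
  have hev : ∀ᶠ n : ℕ in atTop, ∀ k : ℕ, ⌊(1 - ε) * (n : ℝ)⌋₊ < k →
      k ≤ n + ⌊s * ε * (n : ℝ)⌋₊ → |u k - u n| ≤ s * u n := by
    filter_upwards [hflat] with n h1 k hk1 hk2
    have h2 := (Nat.floor_lt (by nlinarith [Nat.cast_nonneg (α := ℝ) n])).1 hk1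
    have h3 : (k : ℝ) ≤ n + (⌊s * ε * (n : ℝ)⌋₊ : ℝ) := by exact_mod_cast hk2
    have h4 := Nat.floor_le (by positivity : 0 ≤ s * ε * (n : ℝ))
    have h5 : ε * (n : ℝ) ≤ δ * n := by gcongr; linarith
    have h6 : s * ε * (n : ℝ) ≤ δ * n := by gcongr; nlinarith
    exact h1 k (abs_le.2 ⟨by linarith, by linarith⟩)
  have hup := h.increment_eventually_le hU hpos (K := 1 + s) (x := (1 + 4 * s) * ε) hε
    hη (by nlinarith) ha hp
    (fun n => Nat.floor_le_of_le (by nlinarith [Nat.cast_nonneg (α := ℝ) n]))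
    (hev.mono fun n hn k hk1 hk2 => by linarith [(abs_le.1 (hn k hk1 hk2)).2])
    (by nlinarith [mul_pos hs hε])
  have hlo := h.eventually_le_increment hU hpos (K := 1 - s) (x := (1 - 4 * s) * ε) (by linarith)
    hη (by nlinarith) ha hp hC
    (hcomp.mono fun n hn k hk1 hk2 => hn k hk1 (by
      have : (k : ℝ) ≤ n := by exact_mod_cast hk2
      have := Nat.cast_nonneg (α := ℝ) n
      linarith))
    (hev.mono fun n hn k hk1 hk2 => by
      linarith [(abs_le.1 (hn k hk1 (hk2.trans (Nat.le_add_right _ _)))).1])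
    (by nlinarith [mul_pos hs hε])
  have hZ := (h.tendsto_tail_mul_cumul hU).pow 2
  rw [one_pow] at hZ
  filter_upwards [hup, hlo, hpos, eventually_gt_atTop 0,
    hZ.eventually_lt_const (by linarith : 1 < 1 + s),
    hZ.eventually_const_lt (by linarith : 1 - s < 1)] with n h1 h2 h3 hn h4 h5
  have hn' : (0 : ℝ) < n := by exact_mod_cast hn
  set G := T ⌊(1 - ε) * (n : ℝ)⌋₊ - T n
  have q1 := h.cumul_pos n
  set Un := cumul u n
  have hA : 0 < ε * (n * u n) := by positivity
  -- multiplied by `U n ^ 2`, the claim compares `G * U n ^ 2 ≈ ε * n * u n` and `(T n * U n) ^ 2 ≈ 1`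
  refine le_of_mul_le_mul_right ?_ (by positivity : 0 < Un ^ 2)
  rw [← abs_of_pos (by positivity : 0 < Un ^ 2), ← abs_mul, abs_of_pos (by positivity : 0 < Un ^ 2)]
  have e1 : (G - ε * n * (T n ^ 2 * u n)) * Un ^ 2 =
      G * Un ^ 2 - (T n * Un) ^ 2 * (ε * (n * u n)) := by ring
  have e2 : θ * (ε * n * (T n ^ 2 * u n)) * Un ^ 2 =
      θ * (T n * Un) ^ 2 * (ε * (n * u n)) := by ring
  rw [e1, e2]
  set Z := (T n * Un) ^ 2
  set A := ε * (n * u n)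
  have h6 : G * Un ^ 2 ≤ (1 + 4 * s) * A := h1.trans_eq (by ring)
  have h7 : (1 - 4 * s) * A ≤ G * Un ^ 2 := le_trans (by simp only [A]; linarith) h2
  have h8 : 5 * s ≤ θ * Z := by nlinarith
  have h9 : 5 * s * A ≤ θ * Z * A := by gcongr
  have h10 : Z * A ≤ (1 + s) * A := by gcongr
  have h11 : (1 - s) * A ≤ Z * A := by gcongr
  rw [abs_le]
  constructor <;> linarith

end IsRenewalPair

/-! ### The renewal process -/

lemma renewalTime_succ {Ω : Type*} (ξ : ℕ → Ω → ℕ∞) (k : ℕ) (ω : Ω) :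
    renewalTime ξ (k + 1) ω = renewalTime ξ k ω + ξ k ω :=
  Finset.sum_range_succ _ _

lemma renewalTime_one {Ω : Type*} (ξ : ℕ → Ω → ℕ∞) (ω : Ω) : renewalTime ξ 1 ω = ξ 0 ω := by
  simp [renewalTime]

lemma renewalTime_mono {Ω : Type*} (ξ : ℕ → Ω → ℕ∞) (ω : Ω) : Monotone fun k => renewalTime ξ k ω :=
  fun _ _ hij => Finset.sum_le_sum_of_subset (Finset.range_subset_range.2 hij)

lemma le_renewalTime {Ω : Type*} {ξ : ℕ → Ω → ℕ∞} {ω : Ω} (hω : ∀ i, 1 ≤ ξ i ω)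
    (k : ℕ) : (k : ℕ∞) ≤ renewalTime ξ k ω := by
  induction k with
  | zero => simp
  | succ k ih =>
    rw [renewalTime_succ, Nat.cast_succ]
    exact add_le_add ih (hω k)

namespace IsInterarrival

variable {Ω : Type*} [MeasurableSpace Ω] {ξ : ℕ → Ω → ℕ∞} {P : Measure Ω}

lemma ae_one_le (hξ : IsInterarrival ξ P) : ∀ᵐ ω ∂P, ∀ i, 1 ≤ ξ i ω := by
  rw [ae_all_iff]
  exact fun i => (hξ.identDistrib i).symm.ae_snd (p := fun z => 1 ≤ z) (MeasurableSet.of_discrete)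
    hξ.pos

lemma measurable_renewalTime (hξ : IsInterarrival ξ P) (k : ℕ) :
    Measurable (renewalTime ξ k) :=
  Finset.measurable_fun_sum _ fun i _ => hξ.measurable i

lemma indepFun_renewalTime (hξ : IsInterarrival ξ P) (k : ℕ) :
    IndepFun (renewalTime ξ k) (ξ k) P := by
  have := hξ.indep.indepFun_sum_range_succ hξ.measurable k
  convert this using 1
  ext ω
  simp [renewalTime]

lemma prob_last_renewal (hξ : IsInterarrival ξ P) [IsProbabilityMeasure P] (j k m : ℕ) :
    P.real {ω | renewalTime ξ j ω = k ∧ (m : ℕ∞) < ξ j ω} =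
      P.real {ω | renewalTime ξ j ω = k} * interarrivalTail ξ P m := by
  have h1 := (hξ.indepFun_renewalTime j).measure_inter_preimage_eq_mul {(k : ℕ∞)}
    (Set.Ioi (m : ℕ∞)) MeasurableSet.of_discrete MeasurableSet.of_discrete
  have h2 := (hξ.identDistrib j).measure_mem_eq
    (MeasurableSet.of_discrete (s := Set.Ioi (m : ℕ∞)))
  rw [h2] at h1
  simp only [interarrivalTail, renewalTime_one, measureReal_def, ← ENNReal.toReal_mul]
  exact congrArg ENNReal.toReal h1

/-- The renewal mass as a sum over the index of the renewal, which is at most its time. -/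
lemma renewalMass_eq_sum (hξ : IsInterarrival ξ P) [IsProbabilityMeasure P] {k n : ℕ}
    (hkn : k ≤ n) : renewalMass ξ P k =
      ∑ j ∈ Finset.range (n + 1), P.real {ω | renewalTime ξ j ω = k} := by
  have hmeas : ∀ j, MeasurableSet {ω | renewalTime ξ j ω = k} := fun j =>
    hξ.measurable_renewalTime j (measurableSet_singleton _)
  rw [← measureReal_biUnion_finset₀ _ fun j _ => (hmeas j).nullMeasurableSet]
  · refine measureReal_congr ?_
    filter_upwards [hξ.ae_one_le] with ω hω
    refine propext ⟨?_, ?_⟩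
    · rintro ⟨j, hj⟩
      have h1 := le_renewalTime hω j
      rw [hj] at h1
      have h2 : j ≤ k := by exact_mod_cast h1
      exact Set.mem_biUnion (Finset.mem_coe.2 (Finset.mem_range.2 (by lia))) hj
    · intro h1
      obtain ⟨j, -, hj⟩ := Set.mem_iUnion₂.1 h1
      exact ⟨j, hj⟩
  · have key : ∀ i j, i < j →
        AEDisjoint P {ω | renewalTime ξ i ω = k} {ω | renewalTime ξ j ω = k} := by
      intro i j hij
      refine measure_mono_null ?_ (ae_iff.1 hξ.ae_one_le)
      rintro ω ⟨h1, h2⟩ hω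
      have h1 : renewalTime ξ i ω = k := h1
      have h2 : renewalTime ξ j ω = k := h2
      have h3 : renewalTime ξ (i + 1) ω ≤ renewalTime ξ j ω := renewalTime_mono ξ ω hij
      rw [renewalTime_succ, h1, h2] at h3
      have h4 := (add_le_add_right (hω i) (k : ℕ∞)).trans h3
      have h5 : k + 1 ≤ k := by exact_mod_cast h4
      lia
    intro i _ j _ hij
    rcases lt_or_gt_of_ne hij with h1 | h1
    · exact key i j h1
    · exact (key j i h1).symm

/-- Exactly one pair `(j, k)` with `k ≤ n` has `τ_j = k` and no renewal in `(k, n]`. -/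
lemma last_renewal (hξ : IsInterarrival ξ P) [IsProbabilityMeasure P] (n : ℕ) :
    ∑ k ∈ Finset.range (n + 1), renewalMass ξ P k * interarrivalTail ξ P (n - k) = 1 := by
  set E : ℕ × ℕ → Set Ω := fun x =>
    {ω | renewalTime ξ x.1 ω = x.2 ∧ ((n - x.2 : ℕ) : ℕ∞) < ξ x.1 ω} with hE
  have hmeas : ∀ x, MeasurableSet (E x) := fun x =>
    (hξ.measurable_renewalTime x.1 (measurableSet_singleton _)).inter
      (hξ.measurable x.1 (MeasurableSet.of_discrete (s := Set.Ioi _)))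
  -- on `E (j, k)` the `j`-th renewal is the last one up to time `n`
  have hEn : ∀ x ω, x.2 ≤ n → ω ∈ E x →
      renewalTime ξ x.1 ω = x.2 ∧ (n : ℕ∞) < renewalTime ξ (x.1 + 1) ω := by
    rintro ⟨j, k⟩ ω hk ⟨h1, h2⟩
    refine ⟨h1, ?_⟩
    dsimp only at h1 h2 hk ⊢
    rw [renewalTime_succ, h1]
    rcases eq_or_ne (ξ j ω) ⊤ with h3 | h3
    · simp [h3]
    · obtain ⟨m, hm⟩ := ENat.ne_top_iff_exists.1 h3
      rw [← hm] at h2 ⊢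
      have h4 : n - k < m := by exact_mod_cast h2
      have h5 : n < k + m := by lia
      exact_mod_cast h5
  have h1 : ∑ x ∈ Finset.range (n + 1) ×ˢ Finset.range (n + 1), P.real (E x) = 1 := by
    rw [← measureReal_biUnion_finset₀ _ fun x _ => (hmeas x).nullMeasurableSet,
      ← probReal_univ (μ := P)]
    · refine measureReal_congr ?_
      filter_upwards [hξ.ae_one_le] with ω hω
      refine propext ⟨fun _ => trivial, fun _ => ?_⟩
      have hex : ∃ j, (n : ℕ∞) < renewalTime ξ (j + 1) ω :=
        ⟨n, lt_of_lt_of_le (by exact_mod_cast n.lt_succ_self) (le_renewalTime hω (n + 1))⟩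
      classical
      set j := Nat.find hex with hj
      have hj1 : (n : ℕ∞) < renewalTime ξ (j + 1) ω := Nat.find_spec hex
      have hj2 : renewalTime ξ j ω ≤ n := by
        rcases Nat.eq_zero_or_pos j with h0 | h0
        · simp [h0, renewalTime]
        · have := Nat.find_min hex (m := j - 1) (by lia)
          rw [Nat.sub_add_cancel h0] at this
          exact not_lt.1 this
      obtain ⟨k, hk⟩ := ENat.ne_top_iff_exists.1 (ne_top_of_le_ne_top (ENat.natCast_ne_top n) hj2)
      rw [← hk] at hj2
      have hkn : k ≤ n := by exact_mod_cast hj2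
      have hjk := le_renewalTime hω j
      rw [← hk] at hjk
      have hjk' : j ≤ k := by exact_mod_cast hjk
      refine Set.mem_biUnion (x := (j, k)) (by simp; lia) ⟨hk.symm, ?_⟩
      rw [renewalTime_succ, ← hk] at hj1
      dsimp only
      rcases eq_or_ne (ξ j ω) ⊤ with h3 | h3
      · rw [h3]; exact ENat.natCast_lt_top _
      · obtain ⟨m, hm⟩ := ENat.ne_top_iff_exists.1 h3
        rw [← hm] at hj1 ⊢
        have h4 : n < k + m := by exact_mod_cast hj1
        have h5 : n - k < m := by lia
        exact_mod_cast h5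
    · have hidx : ∀ (x y : ℕ × ℕ) ω, x.2 ≤ n → y.2 ≤ n → ω ∈ E x → ω ∈ E y → x.1 ≤ y.1 := by
        intro x y ω hx hy h1 h2
        by_contra! hlt
        have h3 : (n : ℕ∞) < renewalTime ξ x.1 ω :=
          (hEn y ω hy h2).2.trans_le (renewalTime_mono ξ ω hlt)
        rw [(hEn x ω hx h1).1] at h3
        have h4 : n < x.2 := by exact_mod_cast h3
        lia
      intro x hx y hy hxy
      refine Disjoint.aedisjoint (Set.disjoint_left.2 fun ω h1 h2 => hxy ?_)
      simp only [Finset.coe_product, Set.mem_prod, Finset.mem_coe, Finset.mem_range] at hx hy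
      have e := le_antisymm (hidx x y ω (by lia) (by lia) h1 h2)
        (hidx y x ω (by lia) (by lia) h2 h1)
      refine Prod.ext e ?_
      have h3 := h1.1
      rw [e, h2.1] at h3
      exact_mod_cast h3.symm
  rw [← h1, Finset.sum_product_right]
  refine Finset.sum_congr rfl fun k hk => ?_
  rw [hξ.renewalMass_eq_sum (Nat.lt_succ_iff.1 (Finset.mem_range.1 hk)), Finset.sum_mul]
  exact Finset.sum_congr rfl fun j _ => (hξ.prob_last_renewal j k (n - k)).symm

lemma isRenewalPair (hξ : IsInterarrival ξ P) [IsProbabilityMeasure P] :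
    IsRenewalPair (renewalMass ξ P) (interarrivalTail ξ P) where
  mass_nonneg _ := measureReal_nonneg
  tail_nonneg _ := measureReal_nonneg
  tail_antitone _ _ hmn :=
    measureReal_mono fun _ hω => lt_of_le_of_lt (by exact_mod_cast hmn) (Set.mem_ofPred_eq ▸ hω)
  last_renewal := hξ.last_renewal

lemma sum_interarrivalMass (hξ : IsInterarrival ξ P) [IsProbabilityMeasure P] {m n : ℕ}
    (hmn : m ≤ n) : ∑ k ∈ Finset.Ioc m n, interarrivalMass ξ P k =
      interarrivalTail ξ P m - interarrivalTail ξ P n := by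
  induction n, hmn using Nat.le_induction with
  | base => simp
  | succ n hmn ih =>
    rw [← Finset.insert_Ioc_right_eq_Ioc_add_one (by lia), Finset.sum_insert (by simp), ih]
    have h1 : interarrivalTail ξ P n =
        interarrivalTail ξ P (n + 1) + interarrivalMass ξ P (n + 1) := by
      unfold interarrivalTail interarrivalMass
      rw [← measureReal_union]
      · congr 1
        ext ω
        simp only [Set.mem_ofPred_eq, Set.mem_union, Nat.cast_add, Nat.cast_one]
        rw [← Order.add_one_le_iff_of_not_isMax (by simp), le_iff_lt_or_eq, eq_comm]
      · exact Set.disjoint_left.2 fun ω h1 h2 => (ne_of_gt h1) h2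
      · exact hξ.measurable_renewalTime 1 (measurableSet_singleton _)
    linarith

end IsInterarrival

/-! ### From fixed windows to shrinking windows -/

lemma isEquivalent_of_eventually_le {f g : ℕ → ℝ} (hg : ∀ n, 0 ≤ g n)
    (h : ∀ θ : ℝ, 0 < θ → ∀ᶠ n in atTop, |f n - g n| ≤ θ * g n) : f ~[atTop] g := by
  refine isLittleO_iff.2 fun θ hθ => ?_
  filter_upwards [h θ hθ] with n hn
  simpa [Real.norm_eq_abs, abs_of_nonneg (hg n)] using hn

/-- Diagonal extraction: if each `Q j` holds eventually, then so does `Q (φ n) n`, for some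
`φ → ∞` growing slowly enough. -/
lemma exists_tendsto_atTop_diagonal {Q : ℕ → ℕ → Prop} (hQ : ∀ j, ∀ᶠ n in atTop, Q j n) :
    ∃ φ : ℕ → ℕ, Tendsto φ atTop atTop ∧ ∀ᶠ n in atTop, Q (φ n) n := by
  classical
  choose N hN using fun j => eventually_atTop.1 (hQ j)
  refine ⟨fun n => Nat.findGreatest (fun j => N j ≤ n) n, ?_, ?_⟩
  · refine tendsto_atTop.2 fun J => ?_
    filter_upwards [eventually_ge_atTop (max J (N J))] with n hn
    exact Nat.le_findGreatest ((le_max_left _ _).trans hn) ((le_max_right _ _).trans hn)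
  · filter_upwards [eventually_ge_atTop (N 0)] with n hn
    exact hN _ _ (Nat.findGreatest_spec (P := fun j => N j ≤ n) (Nat.zero_le n) hn)

/-- If `A ε` approximates `R` at infinity up to a relative error which vanishes with `ε`, then so
does `A (ε n)` along some `ε n → 0` slow enough that `ε n * n → ∞`. -/
lemma exists_shrinking_windows {A : ℝ → ℕ → ℝ} {R : ℕ → ℝ} (hR : ∀ n, 0 ≤ R n)
    (hA : ∀ θ : ℝ, 0 < θ → ∃ ε₀ : ℝ, 0 < ε₀ ∧ ε₀ < 1 ∧ ∀ ε, 0 < ε → ε ≤ ε₀ →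
      ∀ᶠ n : ℕ in atTop, |A ε n - R n| ≤ θ * R n) :
    ∃ ε : ℕ → ℝ, (∀ n, 0 < ε n ∧ ε n < 1) ∧ Tendsto ε atTop (𝓝 0) ∧
      Tendsto (fun n : ℕ => ε n * (n : ℝ)) atTop atTop ∧ (fun n => A (ε n) n) ~[atTop] R := by
  choose ε₀ h0 h1 h2 using fun j : ℕ => hA (1 / ((j : ℝ) + 1)) (by positivity)
  set e : ℕ → ℝ := fun j => min (ε₀ j) (1 / ((j : ℝ) + 1)) with he
  have he0 : ∀ j, 0 < e j := fun j => lt_min (h0 j) (by positivity)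
  have hlim : Tendsto e atTop (𝓝 0) :=
    squeeze_zero (fun j => (he0 j).le) (fun j => min_le_right _ _)
      tendsto_one_div_add_atTop_nhds_zero_nat
  obtain ⟨φ, hφ, hQ⟩ := exists_tendsto_atTop_diagonal
    (Q := fun j n => |A (e j) n - R n| ≤ 1 / ((j : ℝ) + 1) * R n ∧ (j : ℝ) ≤ e j * n)
    fun j => (h2 j (e j) (he0 j) (min_le_left _ _)).and
      ((tendsto_natCast_atTop_atTop.const_mul_atTop (he0 j)).eventually_ge_atTop _)
  refine ⟨fun n => e (φ n), fun n => ⟨he0 _, (min_le_left _ _).trans_lt (h1 _)⟩, hlim.comp hφ,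
    tendsto_atTop_mono' _ (hQ.mono fun n hn => hn.2) (tendsto_natCast_atTop_atTop.comp hφ),
    isEquivalent_of_eventually_le hR fun θ hθ => ?_⟩
  have h3 := (tendsto_one_div_add_atTop_nhds_zero_nat (𝕜 := ℝ)).comp hφ
  filter_upwards [hQ, h3.eventually_le_const hθ] with n h4 h5
  exact h4.1.trans (mul_le_mul_of_nonneg_right h5 (hR n))

/-- A regularly varying sequence is equivalent to its averages over short windows. -/
lemma RegularlyVaryingSeq.window_average {f : ℕ → ℝ} (hf : RegularlyVaryingSeq f) {θ : ℝ}
    (hθ : 0 < θ) : ∃ ε₀ : ℝ, 0 < ε₀ ∧ ∀ ε, 0 < ε → ε ≤ ε₀ → ε < 1 → ∀ᶠ n : ℕ in atTop,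
      |1 / (ε * n) * ∑ k ∈ Finset.Ioc ⌊(1 - ε) * (n : ℝ)⌋₊ n, f k - f n| ≤ θ * f n := by
  obtain ⟨s, hs, hs1, hsθ⟩ : ∃ s : ℝ, 0 < s ∧ s ≤ 1 ∧ 3 * s ≤ θ :=
    ⟨min 1 (θ / 3), by positivity, min_le_left _ _, by linarith [min_le_right 1 (θ / 3)]⟩
  obtain ⟨δ, hδ, hflat⟩ := hf.locally_flat hs
  refine ⟨δ, hδ, fun ε hε hεδ hε1 => ?_⟩
  have ha := tendsto_floor_mul_div (c := 1 - ε) (by linarith)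
  filter_upwards [hflat, hf.eventually_pos, eventually_gt_atTop 0,
    ha.eventually_lt_const (by nlinarith : 1 - ε < 1 - ε + s * ε),
    ha.eventually_const_lt (by nlinarith : 1 - ε - s * ε < 1 - ε)] with n h1 h2 hn h3 h4
  have hn' : (0 : ℝ) < n := by exact_mod_cast hn
  have h0 : 0 ≤ (1 - ε) * (n : ℝ) := mul_nonneg (by linarith) hn'.le
  rw [div_lt_iff₀ hn'] at h3
  rw [lt_div_iff₀ hn'] at h4
  set a := ⌊(1 - ε) * (n : ℝ)⌋₊ with hadef
  have han : a ≤ n := Nat.floor_le_of_le (by nlinarith)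
  have h5 : |∑ k ∈ Finset.Ioc a n, f k - ((n : ℝ) - a) * f n| ≤ ((n : ℝ) - a) * (s * f n) := by
    have e : ∀ x : ℝ, ((n : ℝ) - a) * x = ∑ k ∈ Finset.Ioc a n, x := fun x => by
      simp [Nat.cast_sub han]
    rw [e, e, ← Finset.sum_sub_distrib]
    refine (Finset.abs_sum_le_sum_abs _ _).trans (Finset.sum_le_sum fun k hk => h1 k ?_)
    obtain ⟨hk1, hk2⟩ := Finset.mem_Ioc.1 hk
    have hk3 := (Nat.floor_lt h0).1 hk1
    have hk4 : (k : ℝ) ≤ n := by exact_mod_cast hk2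
    have : ε * (n : ℝ) ≤ δ * n := by gcongr
    exact abs_le.2 ⟨by linarith, by linarith⟩
  have hεn : 0 < ε * (n : ℝ) := by positivity
  refine le_of_mul_le_mul_left ?_ hεn
  nth_rewrite 1 [← abs_of_pos hεn]
  rw [← abs_mul, mul_sub, ← mul_assoc, mul_one_div_cancel hεn.ne', one_mul]
  set W := ∑ k ∈ Finset.Ioc a n, f k
  have h6 : W - ε * n * f n = (W - ((n : ℝ) - a) * f n) + (((n : ℝ) - a) - ε * n) * f n := by ring
  rw [h6]
  refine (abs_add_le _ _).trans ?_
  rw [abs_mul, abs_of_pos h2]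
  have h7 : |((n : ℝ) - a) - ε * n| ≤ s * (ε * n) := abs_le.2 ⟨by linarith, by linarith⟩
  have h8 : |((n : ℝ) - a) - ε * n| * f n ≤ s * (ε * n) * f n := by gcongr
  have h9 : (n : ℝ) - a ≤ 2 * (ε * n) := by nlinarith [(abs_le.1 h7).2]
  have h10 : ((n : ℝ) - a) * (s * f n) ≤ 2 * (ε * n) * (s * f n) := by gcongr
  have h11 : 3 * s * (ε * n * f n) ≤ θ * (ε * n * f n) := by gcongr
  linarith

end Renewal

theorem theorem3 {Ω : Type*} [MeasurableSpace Ω] (P : Measure Ω) [IsProbabilityMeasure P]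
    (ξ : ℕ → Ω → ℕ∞) (hξ : Renewal.IsInterarrival ξ P)
    (hu : Renewal.RegularlyVaryingSeq (Renewal.renewalMass ξ P))
    (hU : Renewal.SlowlyVaryingSeq (Renewal.renewalSum ξ P)) :
    (∃ ε : ℕ → ℝ, (∀ n, 0 < ε n ∧ ε n < 1) ∧ Tendsto ε atTop (𝓝 0) ∧
      Tendsto (fun n : ℕ => ε n * (n : ℝ)) atTop atTop ∧
      (fun n : ℕ => 1 / (ε n * (n : ℝ)) *
          ∑ k ∈ (Finset.range (n + 1)).filter (fun k : ℕ => (1 - ε n) * (n : ℝ) < (k : ℝ)),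
            Renewal.interarrivalMass ξ P k)
        ~[atTop] (fun n : ℕ =>
          Renewal.interarrivalTail ξ P n ^ 2 * Renewal.renewalMass ξ P n)) ∧
    (Renewal.RegularlyVaryingSeq (Renewal.interarrivalMass ξ P) →
      (fun n : ℕ => Renewal.interarrivalMass ξ P n)
        ~[atTop] (fun n : ℕ =>
          Renewal.interarrivalTail ξ P n ^ 2 * Renewal.renewalMass ξ P n)) := by
  have h := hξ.isRenewalPair
  have hU' : Renewal.SlowlyVaryingSeq (Renewal.cumul (Renewal.renewalMass ξ P)) := hU
  set f := Renewal.interarrivalMass ξ P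
  set R : ℕ → ℝ := fun n => Renewal.interarrivalTail ξ P n ^ 2 * Renewal.renewalMass ξ P n
    with hRdef
  have hR : ∀ n, 0 ≤ R n := fun n => mul_nonneg (sq_nonneg _) (h.mass_nonneg n)
  have hfilter : ∀ (ε : ℝ) (n : ℕ), ε < 1 →
      (Finset.range (n + 1)).filter (fun k : ℕ => (1 - ε) * (n : ℝ) < (k : ℝ)) =
        Finset.Ioc ⌊(1 - ε) * (n : ℝ)⌋₊ n := by
    intro ε n hε
    ext k
    rw [Finset.mem_filter, Finset.mem_range, Finset.mem_Ioc,
      Nat.floor_lt (mul_nonneg (by linarith) (Nat.cast_nonneg n)), Nat.lt_succ_iff, and_comm]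
  have key : ∀ θ : ℝ, 0 < θ → ∃ ε₀ : ℝ, 0 < ε₀ ∧ ε₀ < 1 ∧ ∀ ε, 0 < ε → ε ≤ ε₀ →
      ∀ᶠ n : ℕ in atTop,
        |1 / (ε * (n : ℝ)) * ∑ k ∈ Finset.Ioc ⌊(1 - ε) * (n : ℝ)⌋₊ n, f k - R n| ≤ θ * R n := by
    intro θ hθ
    obtain ⟨ε₀, h0, h1, H⟩ := h.increment_asymptotic hU' hu hθ
    refine ⟨ε₀, h0, h1, fun ε hε hε0 => ?_⟩
    filter_upwards [H ε hε hε0, eventually_gt_atTop 0] with n h2 hn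
    have hn' : (0 : ℝ) < n := by exact_mod_cast hn
    rw [hξ.sum_interarrivalMass (Nat.floor_le_of_le (by nlinarith))]
    have hεn : 0 < ε * (n : ℝ) := by positivity
    refine le_of_mul_le_mul_left ?_ hεn
    nth_rewrite 1 [← abs_of_pos hεn]
    rw [← abs_mul, mul_sub, ← mul_assoc, mul_one_div_cancel hεn.ne', one_mul]
    exact h2.trans_eq (by ring)
  refine ⟨?_, fun hf => Renewal.isEquivalent_of_eventually_le hR fun θ hθ => ?_⟩
  · refine Renewal.exists_shrinking_windows (A := fun ε n => 1 / (ε * (n : ℝ)) *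
      ∑ k ∈ (Finset.range (n + 1)).filter (fun k : ℕ => (1 - ε) * (n : ℝ) < (k : ℝ)), f k) hR
      fun θ hθ => ?_
    obtain ⟨ε₀, h0, h1, H⟩ := key θ hθ
    refine ⟨ε₀, h0, h1, fun ε hε hε0 => (H ε hε hε0).mono fun n hn => ?_⟩
    rwa [hfilter ε n (hε0.trans_lt h1)]
  · -- both `f n` and `R n` are close to the average of `f` over the same short window
    obtain ⟨s, hs, hs1, hsθ⟩ : ∃ s : ℝ, 0 < s ∧ s ≤ 1 / 2 ∧ 4 * s ≤ θ :=
      ⟨min (1 / 2) (θ / 4), by positivity, min_le_left _ _, by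
        linarith [min_le_right (1 / 2) (θ / 4)]⟩
    obtain ⟨ε₀, h0, h1, H⟩ := key s hs
    obtain ⟨ε₁, h2, H'⟩ := hf.window_average hs
    have hε := min_le_left ε₀ ε₁
    filter_upwards [H _ (lt_min h0 h2) hε,
      H' _ (lt_min h0 h2) (min_le_right _ _) (hε.trans_lt h1)] with n h3 h4
    have h3' := abs_le.1 h3
    have h4' := abs_le.1 h4
    have hRn := hR n
    have h5 : (1 - s) * f n ≤ (1 + s) * R n := by linarith [h3'.2, h4'.1]
    have h6 : f n ≤ 3 * R n := by nlinarith
    have h7 : s * f n ≤ s * (3 * R n) := by gcongr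
    have h8 : 4 * s * R n ≤ θ * R n := by gcongr
    exact abs_le.2 ⟨by linarith [h3'.1, h4'.2], by linarith [h3'.2, h4'.1]⟩
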